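/- Let $\mathfrak g$ be a finite dimensional complex Lie algebra with basis $(X_i)$ and structure constants $[X_i,X_j]=\sum_k c_{ij}^kX_k$, and let $V_\tau$ be a finite dimensional complex representation of $\mathfrak g$. For $t\in\mathbb C$ put $U_t(\mathfrak g)=T(\mathfrak g)/(X\otimes Y-Y\otimes X-t[X,Y])$, so that $U_1(\mathfrak g)=U(\mathfrak g)$, and let $I_{PBW}:S(\mathfrak g)\to U_t(\mathfrak g)$ be the linear map $Y_1\cdots Y_k\mapsto\frac1{k!}\sum_{\sigma\in S_k}Y_{\sigma(1)}\cdots Y_{\sigma(k)}$ (for $Y_1,\dots,Y_k\in\mathfrak g$). On $S(\mathfrak g)$ let $\{a,b\}=\sum_{i,j,k}c_{ij}^kX_k\,\partial^ia\,\partial^jb$, where $\partial^i$ is the partial derivative with respect to $X_i$, and extend it to a bilinear map on $\mathrm{End}V_\tau\otimes S(\mathfrak g)$ by $\{A\otimes a,B\otimes b\}=AB\otimes\{a,b\}$ (the noncommutative Poisson bracket). For every $t\in\mathbb C$ the map $F_{PBW}=\mathrm{Id}\otimes I_{PBW}:\mathrm{End}V_\tau\otimes S(\mathfrak g)\to\mathrm{End}V_\tau\otimes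 U_t(\mathfrak g)$ is bijective, so that the star product $\mathcal A*_t\mathcal B=F_{PBW}^{-1}(F_{PBW}(\mathcal A)\cdot F_{PBW}(\mathcal B))$ is well defined on $\mathrm{End}V_\tau\otimes S(\mathfrak g)$ and $F_{PBW}$ carries $*_t$ to the product of $\mathrm{End}V_\tau\otimes U_t(\mathfrak g)$; in particular, for $t=1$ it carries $*_1$ to the product of $\mathrm{End}V_\tau\otimes U(\mathfrak g)$. Moreover $$\mathcal A*_t\mathcal B=\mathcal A\mathcal B+\frac t2\{\mathcal A,\mathcal B\}+O(t^2),$$ in the following sense: there are bilinear maps $m_0,m_1,m_2,\dots$ from $\mathrm{End}V_\tau\otimes S(\mathfrak g)$ to itself, independent of $t$, such that for all $\mathcal A,\mathcal B$ only finitely many $m_n(\mathcal A,\mathcal B)$ are non-zero and, for all $t\in\mathbb C$, $$\mathcal A*_t\mathcal B=\mathcal A\mathcal B+\frac t2\{\mathcal A,\mathcal B\}+t^2\sum_{n\ge0}t^n\,m_n(\mathcal A,\mathcal B).$$ In other words, the noncommutative Poisson bracket (times $\frac12$) is the first-order term of the deformation of $\mathrm{End}V_\tau\otimes S(\mathfrak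 g)$ into $\mathrm{End}V_\tau\otimes U(\mathfrak g)$. -/

import Mathlib

open scoped TensorProduct Nat

noncomputable section

namespace FamilyAlgebra

universe u v w

section Deformation

variable (𝔤 : Type u) [LieRing 𝔤] [LieAlgebra ℂ 𝔤]

/-- The relations `X ⊗ Y - Y ⊗ X = t [X, Y]` in the tensor algebra `T(𝔤)`. -/
inductive URel (t : ℂ) : TensorAlgebra ℂ 𝔤 → TensorAlgebra ℂ 𝔤 → Prop
  | lie (x y : 𝔤) : URel t
      (TensorAlgebra.ι ℂ x * TensorAlgebra.ι ℂ y - TensorAlgebra.ι ℂ y * TensorAlgebra.ι ℂ x)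
      (t • TensorAlgebra.ι ℂ ⁅x, y⁆)

/-- The algebra `U_t(𝔤) = T(𝔤) / (X ⊗ Y - Y ⊗ X - t [X, Y])`. -/
abbrev Ut (t : ℂ) : Type u := RingQuot (URel 𝔤 t)

/-- The canonical linear map `𝔤 → U_t(𝔤)`. -/
def Ut.ι (t : ℂ) : 𝔤 →ₗ[ℂ] Ut 𝔤 t :=
  (RingQuot.mkAlgHom ℂ (URel 𝔤 t)).toLinearMap ∘ₗ TensorAlgebra.ι ℂ

lemma Ut.ι_mul_sub (t : ℂ) (x y : 𝔤) :
    Ut.ι 𝔤 t x * Ut.ι 𝔤 t y - Ut.ι 𝔤 t y * Ut.ι 𝔤 t x = t • Ut.ι 𝔤 t ⁅x, y⁆ := by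
  have h := RingQuot.mkAlgHom_rel ℂ (URel.lie (t := t) x y)
  simpa [Ut.ι] using h

/-- The symmetrized product
`(X₁, …, X_k) ↦ (1 / k!) ∑_{σ ∈ S_k} X_{σ(1)} ⋯ X_{σ(k)}` with values in `U_t(𝔤)`. -/
def symProd (t : ℂ) (k : ℕ) : MultilinearMap ℂ (fun _ : Fin k => 𝔤) (Ut 𝔤 t) :=
  ((k ! : ℂ)⁻¹) • ∑ σ : Equiv.Perm (Fin k),
    ((MultilinearMap.mkPiAlgebraFin ℂ k (Ut 𝔤 t)).compLinearMap
      (fun _ => Ut.ι 𝔤 t)).domDomCongr σ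

lemma symProd_apply (t : ℂ) (k : ℕ) (x : Fin k → 𝔤) :
    symProd 𝔤 t k x = ((k ! : ℂ)⁻¹) • ∑ σ : Equiv.Perm (Fin k),
      (List.ofFn fun i => Ut.ι 𝔤 t (x (σ i))).prod := by
  simp [symProd]

lemma symProd_perm (t : ℂ) (k : ℕ) (x : Fin k → 𝔤) (ρ : Equiv.Perm (Fin k)) :
    symProd 𝔤 t k (x ∘ ρ) = symProd 𝔤 t k x := by
  rw [symProd_apply, symProd_apply]
  congr 1
  exact Fintype.sum_equiv (Equiv.mulLeft ρ) _ _ (fun σ => by simp)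

/-- Symmetrization as a linear map on the tensor algebra, with values in `U_t(𝔤)`. -/
def symTensor (t : ℂ) : TensorAlgebra ℂ 𝔤 →ₗ[ℂ] Ut 𝔤 t :=
  (DirectSum.toModule ℂ ℕ (Ut 𝔤 t) fun k => PiTensorProduct.lift (symProd 𝔤 t k)) ∘ₗ
    (TensorAlgebra.equivDirectSum (R := ℂ) (M := 𝔤)).toLinearMap

lemma symTensor_prod (t : ℂ) (k : ℕ) (x : Fin k → 𝔤) :
    symTensor 𝔤 t (List.ofFn fun i => TensorAlgebra.ι ℂ (x i)).prod = symProd 𝔤 t k x := by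
  have h : (List.ofFn fun i => TensorAlgebra.ι ℂ (x i)).prod = TensorAlgebra.tprod ℂ 𝔤 k x := by
    rw [TensorAlgebra.tprod_apply]
  simp only [symTensor, LinearMap.comp_apply, AlgEquiv.toLinearMap_apply, h]
  rw [show TensorAlgebra.equivDirectSum (TensorAlgebra.tprod ℂ 𝔤 k x) = DirectSum.of
    (fun n => ⨂[ℂ]^n 𝔤) k (PiTensorProduct.tprod ℂ x) by
      rw [← TensorAlgebra.toDirectSum_tensorPower_tprod]; rfl]
  rw [← DirectSum.lof_eq_of ℂ, DirectSum.toModule_lof, PiTensorProduct.lift.tprod]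

lemma symTensor_list (t : ℂ) (l : List 𝔤) (n : ℕ) (h : l.length = n) :
    symTensor 𝔤 t (l.map (TensorAlgebra.ι ℂ)).prod =
      symProd 𝔤 t n fun i => l[(i : ℕ)]'(h ▸ i.2) := by
  subst h
  rw [← symTensor_prod]
  congr 2
  apply List.ext_getElem <;> simp

/-- The products `X₁ ⋯ X_k` span the tensor algebra. -/
lemma mem_span_prod (a : TensorAlgebra ℂ 𝔤) :
    a ∈ Submodule.span ℂ (Set.range fun l : List 𝔤 => (l.map (TensorAlgebra.ι ℂ)).prod) := by
  induction a using TensorAlgebra.induction with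
  | algebraMap r =>
    rw [Algebra.algebraMap_eq_smul_one]
    exact Submodule.smul_mem _ _ (Submodule.subset_span ⟨[], by simp⟩)
  | ι x => exact Submodule.subset_span ⟨[x], by simp⟩
  | add a b ha hb => exact Submodule.add_mem _ ha hb
  | mul a b ha hb =>
    have := Submodule.mul_mem_mul ha hb
    rw [Submodule.span_mul_span] at this
    refine Submodule.span_mono ?_ this
    rintro _ ⟨_, ⟨l, rfl⟩, _, ⟨l', rfl⟩, rfl⟩
    exact ⟨l ++ l', by simp⟩

lemma symTensor_swap_list (t : ℂ) (l₁ l₂ : List 𝔤) (x y : 𝔤) :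
    symTensor 𝔤 t ((l₁ ++ x :: y :: l₂).map (TensorAlgebra.ι ℂ)).prod =
      symTensor 𝔤 t ((l₁ ++ y :: x :: l₂).map (TensorAlgebra.ι ℂ)).prod := by
  have hlen : (l₁ ++ x :: y :: l₂).length = l₁.length + (l₂.length + 2) := by simp
  have hlen' : (l₁ ++ y :: x :: l₂).length = l₁.length + (l₂.length + 2) := by simp
  rw [symTensor_list 𝔤 t _ _ hlen, symTensor_list 𝔤 t _ _ hlen',
    ← symProd_perm 𝔤 t _ _ (Equiv.swap (⟨l₁.length, by omega⟩ : Fin (l₁.length + (l₂.length + 2)))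
      ⟨l₁.length + 1, by omega⟩)]
  congr 1
  funext i
  obtain ⟨i, hi⟩ := i
  simp only [Function.comp_apply, Equiv.swap_apply_def, Fin.mk.injEq]
  split_ifs with h1 h2
  · subst h1
    simp
  · subst h2
    simp
  · rcases lt_or_ge i l₁.length with h | h
    · simp [h]
    · obtain ⟨j, rfl⟩ : ∃ j, i = l₁.length + (j + 2) := ⟨i - l₁.length - 2, by omega⟩
      simp

lemma symTensor_swap (t : ℂ) (a b : TensorAlgebra ℂ 𝔤) (x y : 𝔤) :
    symTensor 𝔤 t (a * (TensorAlgebra.ι ℂ x * TensorAlgebra.ι ℂ y) * b) =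
      symTensor 𝔤 t (a * (TensorAlgebra.ι ℂ y * TensorAlgebra.ι ℂ x) * b) := by
  have ha := mem_span_prod 𝔤 a
  have hb := mem_span_prod 𝔤 b
  induction ha using Submodule.span_induction with
  | zero => simp
  | add a a' _ _ ha ha' => simp [add_mul, ha, ha']
  | smul c a _ ha => simp [ha]
  | mem a ha =>
    obtain ⟨l₁, rfl⟩ := ha
    induction hb using Submodule.span_induction with
    | zero => simp
    | add b b' _ _ hb hb' => simp [mul_add, hb, hb']
    | smul c b _ hb => simp [hb]
    | mem b hb =>
      obtain ⟨l₂, rfl⟩ := hb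
      simpa [mul_assoc] using symTensor_swap_list 𝔤 t l₁ l₂ x y

/-- Two tensors are identified when symmetrization cannot tell them apart inside any product. -/
def symCon (t : ℂ) : RingCon (TensorAlgebra ℂ 𝔤) where
  r a b := ∀ u v, symTensor 𝔤 t (u * a * v) = symTensor 𝔤 t (u * b * v)
  iseqv := ⟨fun _ _ _ => rfl, fun h u v => (h u v).symm, fun h h' u v => (h u v).trans (h' u v)⟩
  add' h h' u v := by simp only [mul_add, add_mul, map_add, h u v, h' u v]
  mul' {a b c d} h h' u v := by
    have h1 := h u (c * v)
    have h2 := h' (u * b) v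
    simp only [mul_assoc] at h1 h2 ⊢
    exact h1.trans h2

lemma symTensor_eq_of_algHom_eq (t : ℂ) {a b : TensorAlgebra ℂ 𝔤}
    (h : SymmetricAlgebra.algHom ℂ 𝔤 a = SymmetricAlgebra.algHom ℂ 𝔤 b) :
    symTensor 𝔤 t a = symTensor 𝔤 t b := by
  have h' : TensorAlgebra.symRingCon ℂ 𝔤 a b := (RingCon.eq _).1 h
  have hle : TensorAlgebra.symRingCon ℂ 𝔤 ≤ symCon 𝔤 t := by
    refine RingCon.ringConGen_le.2 ?_
    rintro _ _ ⟨x, y⟩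
    intro u v
    exact symTensor_swap 𝔤 t u v x y
  simpa using hle h' 1 1

/-- The Poincaré–Birkhoff–Witt map `I_PBW : S(𝔤) → U_t(𝔤)`, the linear map with
`X₁ ⋯ X_k ↦ (1 / k!) ∑_{σ ∈ S_k} X_{σ(1)} ⋯ X_{σ(k)}` (see `IPBW_prod`). -/
def IPBW (t : ℂ) : SymmetricAlgebra ℂ 𝔤 →ₗ[ℂ] Ut 𝔤 t where
  toFun := Quotient.lift (symTensor 𝔤 t) fun _ _ h =>
    symTensor_eq_of_algHom_eq 𝔤 t (Quotient.sound h)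
  map_add' a b := by
    obtain ⟨a, rfl⟩ := SymmetricAlgebra.algHom_surjective ℂ 𝔤 a
    obtain ⟨b, rfl⟩ := SymmetricAlgebra.algHom_surjective ℂ 𝔤 b
    exact map_add (symTensor 𝔤 t) a b
  map_smul' c a := by
    obtain ⟨a, rfl⟩ := SymmetricAlgebra.algHom_surjective ℂ 𝔤 a
    rw [← map_smul]
    exact map_smul (symTensor 𝔤 t) c a

lemma IPBW_algHom (t : ℂ) (a : TensorAlgebra ℂ 𝔤) :
    IPBW 𝔤 t (SymmetricAlgebra.algHom ℂ 𝔤 a) = symTensor 𝔤 t a := rfl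

theorem IPBW_prod (t : ℂ) (k : ℕ) (x : Fin k → 𝔤) :
    IPBW 𝔤 t (∏ i, SymmetricAlgebra.ι ℂ 𝔤 (x i)) =
      ((k ! : ℂ)⁻¹) • ∑ σ : Equiv.Perm (Fin k),
        (List.ofFn fun i => Ut.ι 𝔤 t (x (σ i))).prod := by
  have h : (∏ i, SymmetricAlgebra.ι ℂ 𝔤 (x i)) =
      SymmetricAlgebra.algHom ℂ 𝔤 (List.ofFn fun i => TensorAlgebra.ι ℂ (x i)).prod := by
    rw [map_list_prod, List.map_ofFn, ← List.prod_ofFn]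
    rfl
  rw [h, IPBW_algHom, symTensor_prod, symProd_apply]

attribute [local instance] LieRing.ofAssociativeRing

/-- The canonical map `𝔤 → U_1(𝔤)` as a Lie algebra homomorphism. -/
def Ut.lieι : 𝔤 →ₗ⁅ℂ⁆ Ut 𝔤 1 :=
  { Ut.ι 𝔤 1 with
    map_lie' := fun {x y} => by
      have h := Ut.ι_mul_sub 𝔤 1 x y
      rw [one_smul] at h
      exact h.symm }

/-- The identification of `U_1(𝔤)` with the universal enveloping algebra `U(𝔤)`, which is the
identity on `𝔤`. -/
def utOneEquiv : Ut 𝔤 1 ≃ₐ[ℂ] UniversalEnvelopingAlgebra ℂ 𝔤 :=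
  AlgEquiv.ofAlgHom
    (RingQuot.liftAlgHom ℂ ⟨UniversalEnvelopingAlgebra.mkAlgHom ℂ 𝔤, by
      rintro _ _ ⟨x, y⟩
      have h := (UniversalEnvelopingAlgebra.ι ℂ (L := 𝔤)).map_lie x y
      rw [LieRing.of_associative_ring_bracket] at h
      simp only [UniversalEnvelopingAlgebra.ι_apply] at h
      simp [h]⟩)
    (UniversalEnvelopingAlgebra.lift ℂ (Ut.lieι 𝔤))
    (by
      ext x
      have h : Ut.lieι 𝔤 x = RingQuot.mkAlgHom ℂ (URel 𝔤 1) (TensorAlgebra.ι ℂ x) := rfl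
      simp [h])
    (by
      ext x
      have h : Ut.lieι 𝔤 x = RingQuot.mkAlgHom ℂ (URel 𝔤 1) (TensorAlgebra.ι ℂ x) := rfl
      have h' := UniversalEnvelopingAlgebra.lift_ι_apply ℂ (Ut.lieι 𝔤) x
      rw [UniversalEnvelopingAlgebra.ι_apply] at h'
      simp [h', h])

lemma utOneEquiv_ι (x : 𝔤) :
    utOneEquiv 𝔤 (Ut.ι 𝔤 1 x) = UniversalEnvelopingAlgebra.ι ℂ x := by
  simp [utOneEquiv, Ut.ι]

end Deformation

section Poisson

variable {𝔤 : Type u} [LieRing 𝔤] [LieAlgebra ℂ 𝔤] {ι : Type w} [Fintype ι]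
  (X : Module.Basis ι ℂ 𝔤)

/-- The partial derivative `∂ⁱ` on `S(𝔤) = ℂ[X_i]`, for a basis `X_i` of `𝔤`. -/
def partialS (i : ι) : SymmetricAlgebra ℂ 𝔤 →ₗ[ℂ] SymmetricAlgebra ℂ 𝔤 :=
  (SymmetricAlgebra.equivMvPolynomial X).symm.toLinearMap ∘ₗ
    (MvPolynomial.pderiv i : Derivation ℂ _ _).toLinearMap ∘ₗ
      (SymmetricAlgebra.equivMvPolynomial X).toLinearMap

/-- The Poisson bracket `{a, b} = ∑_{i,j,k} c_{ij}^k X_k ∂ⁱa ∂ʲb` on `S(𝔤)`, where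
`[X_i, X_j] = ∑_k c_{ij}^k X_k`. -/
def poissonS : SymmetricAlgebra ℂ 𝔤 →ₗ[ℂ] SymmetricAlgebra ℂ 𝔤 →ₗ[ℂ] SymmetricAlgebra ℂ 𝔤 :=
  LinearMap.mk₂ ℂ
    (fun a b => ∑ i, ∑ j, ∑ k, X.repr ⁅X i, X j⁆ k •
      (SymmetricAlgebra.ι ℂ 𝔤 (X k) * partialS X i a * partialS X j b))
    (by intros; simp [mul_add, add_mul, Finset.sum_add_distrib])
    (by
      intro c a b
      simp only [map_smul, mul_smul_comm, smul_mul_assoc, Finset.smul_sum]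
      simp only [smul_comm c])
    (by intros; simp [mul_add, Finset.sum_add_distrib])
    (by
      intro c a b
      simp only [map_smul, mul_smul_comm, Finset.smul_sum]
      simp only [smul_comm c])

end Poisson

section Family

variable (𝔤 : Type u) [LieRing 𝔤] [LieAlgebra ℂ 𝔤] (V : Type v) [AddCommGroup V] [Module ℂ V]

/-- The algebra `End V ⊗ S(𝔤)`. -/
abbrev CTilde : Type (max u v) := Module.End ℂ V ⊗[ℂ] SymmetricAlgebra ℂ 𝔤

/-- The algebra `End V ⊗ U_t(𝔤)`. -/
abbrev QTildeDef (t : ℂ) : Type (max u v) := Module.End ℂ V ⊗[ℂ] Ut 𝔤 t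

/-- The algebra `End V ⊗ U(𝔤)`. -/
abbrev QTilde : Type (max u v) := Module.End ℂ V ⊗[ℂ] UniversalEnvelopingAlgebra ℂ 𝔤

/-- The Poincaré–Birkhoff–Witt map `Id ⊗ I_PBW : End V ⊗ S(𝔤) → End V ⊗ U_t(𝔤)`. -/
def FPBW (t : ℂ) : CTilde 𝔤 V →ₗ[ℂ] QTildeDef 𝔤 V t :=
  TensorProduct.map LinearMap.id (IPBW 𝔤 t)

/-- The Poincaré–Birkhoff–Witt map `End V ⊗ S(𝔤) → End V ⊗ U(𝔤)`, the case `t = 1`. -/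
def FPBWOne : CTilde 𝔤 V →ₗ[ℂ] QTilde 𝔤 V :=
  TensorProduct.map LinearMap.id (utOneEquiv 𝔤).toLinearMap ∘ₗ FPBW 𝔤 V 1

variable {𝔤 V}

/-- The star product `𝒜 *_t ℬ = F_PBW⁻¹ (F_PBW 𝒜 · F_PBW ℬ)` on `End V ⊗ S(𝔤)`. -/
def star (t : ℂ) (A B : CTilde 𝔤 V) : CTilde 𝔤 V :=
  Function.invFun (FPBW 𝔤 V t) (FPBW 𝔤 V t A * FPBW 𝔤 V t B)

/-- The noncommutative Poisson bracket on `End V ⊗ S(𝔤)`, the bilinear map with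
`{A ⊗ a, B ⊗ b} = A B ⊗ {a, b}`. -/
def poisson {ι : Type w} [Fintype ι] (X : Module.Basis ι ℂ 𝔤) :
    CTilde 𝔤 V →ₗ[ℂ] CTilde 𝔤 V →ₗ[ℂ] CTilde 𝔤 V :=
  TensorProduct.map₂ (LinearMap.mul ℂ (Module.End ℂ V)) (poissonS X)

end Family

end FamilyAlgebra

end

/-! Everything reduces to $\mathfrak g$: tensoring with $\mathrm{End}\,V$ is linear in each factor,
so it suffices to show that $I_{PBW}$ is bijective and that $I_{PBW}(a)\,I_{PBW}(b)$ has a preimage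
polynomial in $t$, with the right coefficients in degrees 0 and 1.

Injectivity: $U_t(\mathfrak g)$ acts on polynomials in an ordered basis so that each $x$ acts as
multiplication by its linear form up to terms of no higher degree (`pbwAction_lie`,
`pbwAction_sub_mem`). Applying $I_{PBW}(p)$ to 1 therefore returns $p$ plus lower-degree terms, so
$I_{PBW}(p)=0$ forces $p=0$.

Surjectivity and expansion: reordering a word in $U_t$ costs $t$ times shorter words that do not
depend on $t$ (`exists_perm_correction`). Averaging over all reorderings gives word
$=I_{PBW}$(commutative word) $+\,t\cdot$(shorter words), and recursion on length yields a normal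
form polynomial in $t$ (`exists_isNormalForm_tensorWord`). Its coefficient of $t$ is half the sum,
over pairs of letters in order, of their bracket times the remaining letters. This quantity changes
sign when the word is reversed, so its average over permutations is zero. In a product of two
symmetrized words only the pairs with one letter in each factor survive, giving $\frac12\{a,b\}$
(`exists_symWord_mul`). -/

noncomputable section

namespace FamilyAlgebra

universe u v w

/-! ### The PBW representation on polynomials in an ordered basis -/

section Representation

open MvPolynomial

/-- The polynomials all of whose monomials have degree less than `n`. -/
def degreeLT (ι R : Type*) [CommRing R] (n : ℕ) : Submodule R (MvPolynomial ι R) :=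
  restrictSupport R {m | m.degree < n}

section Degree

variable {ι R : Type*} [CommRing R]

lemma degreeLT_mono {m n : ℕ} (h : m ≤ n) : degreeLT ι R m ≤ degreeLT ι R n :=
  restrictSupport_mono R fun _ hs => lt_of_lt_of_le hs h

lemma monomial_mem_degreeLT {n : ℕ} {m : ι →₀ ℕ} (h : m.degree < n) (r : R) :
    monomial m r ∈ degreeLT ι R n :=
  (monomial_mem_restrictSupport R).2 (Or.inl h)

lemma degreeLT_zero {p : MvPolynomial ι R} (h : p ∈ degreeLT ι R 0) : p = 0 := by
  rw [degreeLT, mem_restrictSupport_iff] at h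
  rw [← support_eq_empty, Finset.eq_empty_iff_forall_notMem]
  intro m hm
  exact absurd (h hm) (Nat.not_lt_zero _)

lemma exists_mem_degreeLT (p : MvPolynomial ι R) : ∃ n, p ∈ degreeLT ι R n := by
  refine ⟨p.support.sup Finsupp.degree + 1, ?_⟩
  rw [degreeLT, mem_restrictSupport_iff]
  intro m hm
  exact Nat.lt_succ_of_le (Finset.le_sup (f := Finsupp.degree) hm)

lemma degreeLT_induction {n : ℕ} {p : MvPolynomial ι R → Prop}
    (h0 : p 0) (hadd : ∀ f g, p f → p g → p (f + g)) (hsmul : ∀ (r : R) f, p f → p (r • f))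
    (hm : ∀ m : ι →₀ ℕ, m.degree < n → p (monomial m 1))
    {f : MvPolynomial ι R} (hf : f ∈ degreeLT ι R n) : p f := by
  rw [degreeLT, restrictSupport_eq_span] at hf
  induction hf using Submodule.span_induction with
  | mem x h => obtain ⟨m, hm', rfl⟩ := h; exact hm m hm'
  | zero => exact h0
  | add x y _ _ hx hy => exact hadd _ _ hx hy
  | smul a x _ hx => exact hsmul _ _ hx

lemma map_mem_of_degreeLT {n : ℕ} {M : Type*} [AddCommGroup M] [Module R M]
    (F : MvPolynomial ι R →ₗ[R] M) (S : Submodule R M)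
    (hm : ∀ m : ι →₀ ℕ, m.degree < n → F (monomial m 1) ∈ S)
    {f : MvPolynomial ι R} (hf : f ∈ degreeLT ι R n) : F f ∈ S := by
  refine degreeLT_induction (p := fun f => F f ∈ S) (by simp) (fun f g hf hg => ?_)
    (fun r f hf => ?_) hm hf
  · rw [map_add]; exact add_mem hf hg
  · rw [map_smul]; exact S.smul_mem _ hf

lemma X_mul_mem_degreeLT {n : ℕ} (i : ι) {p : MvPolynomial ι R} (hp : p ∈ degreeLT ι R n) :
    X i * p ∈ degreeLT ι R (n + 1) := by
  refine map_mem_of_degreeLT (LinearMap.mulLeft R (X i)) _ (fun m hm => ?_) hp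
  rw [LinearMap.mulLeft_apply, X, monomial_mul]
  exact monomial_mem_degreeLT (by rw [map_add, Finsupp.degree_single]; omega) _

lemma X_mul_monomial_one (i : ι) (m : ι →₀ ℕ) :
    X i * monomial m (1 : R) = monomial (m + Finsupp.single i 1) 1 := by
  rw [X, monomial_mul, one_mul, add_comm]

end Degree

variable {R L ι : Type*} [CommRing R] [LieRing L] [LieAlgebra R L] [LinearOrder ι]
  (b : Module.Basis ι R L)

@[elab_as_elim]
lemma basis_induction {L ι : Type*} [AddCommGroup L] [Module R L] (b : Module.Basis ι R L)
    {p : L → Prop} (zero : p 0) (add : ∀ x y, p x → p y → p (x + y))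
    (smul : ∀ (r : R) x, p x → p (r • x)) (basis : ∀ i, p (b i)) (x : L) : p x := by
  have hx : x ∈ Submodule.span R (Set.range b) := b.mem_span x
  induction hx using Submodule.span_induction with
  | mem x h => obtain ⟨i, rfl⟩ := h; exact basis i
  | zero => exact zero
  | add x y _ _ hx hy => exact add _ _ hx hy
  | smul a x _ hx => exact smul _ _ hx

lemma constr_basisMonomials {ι M : Type*} [AddCommGroup M] [Module R M]
    (f : (ι →₀ ℕ) → M) (m : ι →₀ ℕ) :
    (basisMonomials ι R).constr R f (monomial m 1) = f m := by
  conv_lhs => rw [show monomial m (1 : R) = basisMonomials ι R m by rw [coe_basisMonomials]]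
  rw [Module.Basis.constr_basis]

/-- The linear form of `x` in the coordinates given by a basis. -/
def linForm {L ι : Type*} [AddCommGroup L] [Module R L] (b : Module.Basis ι R L) :
    L →ₗ[R] MvPolynomial ι R :=
  b.constr R fun i => X i

lemma linForm_basis {L ι : Type*} [AddCommGroup L] [Module R L] (b : Module.Basis ι R L) (i : ι) :
    linForm b (b i) = X i := by
  simp [linForm]

lemma linForm_mul_mem_degreeLT {L ι : Type*} [AddCommGroup L] [Module R L]
    (b : Module.Basis ι R L) {n : ℕ} (x : L) {p : MvPolynomial ι R}
    (hp : p ∈ degreeLT ι R n) : linForm b x * p ∈ degreeLT ι R (n + 1) := by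
  induction x using basis_induction b with
  | zero => simp
  | add x y hx hy => rw [map_add, add_mul]; exact add_mem hx hy
  | smul r x hx => rw [map_smul, smul_mul_assoc]; exact Submodule.smul_mem _ _ hx
  | basis i => rw [linForm_basis]; exact X_mul_mem_degreeLT i hp

open Classical in
/-- Successive approximations to the Poincaré–Birkhoff–Witt action on polynomials: the `n`-th one
is correct on polynomials of degree at most `n`. -/
def pbwApprox (t : R) : ℕ → (L →ₗ[R] MvPolynomial ι R →ₗ[R] MvPolynomial ι R)
  | 0 => LinearMap.mul R (MvPolynomial ι R) ∘ₗ linForm b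
  | n + 1 => b.constr R fun i => (basisMonomials ι R).constr R fun m =>
      X i * monomial m 1 +
        if h : ∃ j, j < i ∧ IsLeast (m.support : Set ι) j then
          pbwApprox t n (b h.choose)
            (pbwApprox t n (b i) (monomial (m - Finsupp.single h.choose 1) 1) -
              X i * monomial (m - Finsupp.single h.choose 1) 1) +
            t • pbwApprox t n ⁅b i, b h.choose⁆ (monomial (m - Finsupp.single h.choose 1) 1)
        else 0

lemma pbwApprox_zero (t : R) (x : L) (p : MvPolynomial ι R) :
    pbwApprox b t 0 x p = linForm b x * p := rfl

lemma pbwApprox_succ_of_not (t : R) (n : ℕ) (i : ι) (m : ι →₀ ℕ)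
    (h : ¬ ∃ j, j < i ∧ IsLeast (m.support : Set ι) j) :
    pbwApprox b t (n + 1) (b i) (monomial m 1) = X i * monomial m 1 := by
  rw [pbwApprox, Module.Basis.constr_basis]
  rw [constr_basisMonomials, dif_neg h, add_zero]

/-- The formula is forced: since $j$ is least, $X_jm=b_j\cdot m$ and $b_j\cdot X_im=X_jX_im$, so
$b_i\cdot X_jm=b_j\cdot(b_i\cdot m)+t[b_i,b_j]\cdot m$. Splitting off $X_im$ from $b_i\cdot m$
leaves the recursion acting only on polynomials of degree at most $\deg m$. -/
lemma pbwApprox_succ_of_lt (t : R) (n : ℕ) (i j : ι) (m : ι →₀ ℕ) (hji : j < i)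
    (hj : IsLeast ((m + Finsupp.single j 1).support : Set ι) j) :
    pbwApprox b t (n + 1) (b i) (monomial (m + Finsupp.single j 1) 1) =
      X i * monomial (m + Finsupp.single j 1) 1 +
      (pbwApprox b t n (b j) (pbwApprox b t n (b i) (monomial m 1) - X i * monomial m 1) +
        t • pbwApprox b t n ⁅b i, b j⁆ (monomial m 1)) := by
  have h : ∃ k, k < i ∧ IsLeast ((m + Finsupp.single j 1).support : Set ι) k := ⟨j, hji, hj⟩
  have hc : h.choose = j := h.choose_spec.2.unique hj
  rw [pbwApprox, Module.Basis.constr_basis]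
  rw [constr_basisMonomials, dif_pos h, hc, add_tsub_cancel_right]

lemma exists_eq_add_single {m : ι →₀ ℕ} {j : ι} (h : IsLeast (m.support : Set ι) j) :
    ∃ m', m = m' + Finsupp.single j 1 := by
  refine ⟨m - Finsupp.single j 1, (tsub_add_cancel_of_le ?_).symm⟩
  rw [Finsupp.single_le_iff]
  exact Nat.one_le_iff_ne_zero.2 (Finsupp.mem_support_iff.1 h.1)

/-- The correction terms apply one operator, which raises degree by at most one, to polynomials of
degree below that of the monomial acted on. This bound is what keeps the nested recursion in range.
-/
lemma pbwApprox_sub_mem (t : R) (n : ℕ) : ∀ (k : ℕ) (x : L) (p : MvPolynomial ι R),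
    p ∈ degreeLT ι R k → pbwApprox b t n x p - linForm b x * p ∈ degreeLT ι R k := by
  induction n with
  | zero => intro k x p _; simp [pbwApprox_zero]
  | succ n ih =>
    intro k x p hp
    refine map_mem_of_degreeLT (pbwApprox b t (n + 1) x - LinearMap.mulLeft R (linForm b x)) _
      (fun m hm => ?_) hp
    rw [LinearMap.sub_apply, LinearMap.mulLeft_apply]
    induction x using basis_induction b with
    | zero => simp
    | add x y hx hy =>
      rw [map_add, map_add, LinearMap.add_apply, add_mul, add_sub_add_comm]
      exact add_mem hx hy
    | smul r x hx =>
      rw [map_smul, map_smul, LinearMap.smul_apply, smul_mul_assoc, ← smul_sub]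
      exact Submodule.smul_mem _ _ hx
    | basis i =>
      rw [linForm_basis]
      by_cases h : ∃ j, j < i ∧ IsLeast (m.support : Set ι) j
      · obtain ⟨j, hji, hj⟩ := h
        obtain ⟨m, rfl⟩ := exists_eq_add_single hj
        rw [pbwApprox_succ_of_lt b t n i j m hji hj, add_sub_cancel_left]
        rw [map_add, Finsupp.degree_single] at hm
        obtain ⟨k, rfl⟩ : ∃ k', k = k' + 1 := ⟨k - 1, by omega⟩
        have hmk : monomial m (1 : R) ∈ degreeLT ι R k := monomial_mem_degreeLT (by omega) 1
        have key : ∀ (x : L) (p : MvPolynomial ι R), p ∈ degreeLT ι R k →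
            pbwApprox b t n x p ∈ degreeLT ι R (k + 1) := fun x p hp => by
          rw [← sub_add_cancel (pbwApprox b t n x p) (linForm b x * p)]
          exact add_mem (degreeLT_mono k.le_succ (ih _ _ _ hp)) (linForm_mul_mem_degreeLT b x hp)
        refine add_mem (key _ _ ?_) (Submodule.smul_mem _ _ (key _ _ hmk))
        have := ih k (b i) _ hmk
        rwa [linForm_basis] at this
      · rw [pbwApprox_succ_of_not b t n i m h, sub_self]
        exact zero_mem _

/-- On a monomial of degree at most $n$ the recursive calls see degree at most $n-1$, where the two
previous approximations already agree. Hence the approximations stabilize and `pbwAction` is well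
behaved. -/
lemma pbwApprox_succ_eq (t : R) (n : ℕ) : ∀ (x : L) (p : MvPolynomial ι R),
    p ∈ degreeLT ι R (n + 1) → pbwApprox b t (n + 1) x p = pbwApprox b t n x p := by
  induction n with
  | zero =>
    intro x p hp
    refine sub_eq_zero.1 ((Submodule.mem_bot R).1 (map_mem_of_degreeLT
      (pbwApprox b t 1 x - pbwApprox b t 0 x) ⊥ (fun m hm => ?_) hp))
    have hm0 : m = 0 := by
      rw [← Finsupp.degree_eq_zero_iff]
      omega
    rw [Submodule.mem_bot, LinearMap.sub_apply, sub_eq_zero]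
    induction x using basis_induction b with
    | zero => simp
    | add x y hx hy => simp only [map_add, LinearMap.add_apply, hx, hy]
    | smul r x hx => simp only [map_smul, LinearMap.smul_apply, hx]
    | basis i =>
      rw [pbwApprox_succ_of_not, pbwApprox_zero, linForm_basis]
      rintro ⟨j, -, hj, -⟩
      simp [hm0] at hj
  | succ n ih =>
    intro x p hp
    refine sub_eq_zero.1 ((Submodule.mem_bot R).1 (map_mem_of_degreeLT
      (pbwApprox b t (n + 2) x - pbwApprox b t (n + 1) x) ⊥ (fun m hm => ?_) hp))
    rw [Submodule.mem_bot, LinearMap.sub_apply, sub_eq_zero]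
    induction x using basis_induction b with
    | zero => simp
    | add x y hx hy => simp only [map_add, LinearMap.add_apply, hx, hy]
    | smul r x hx => simp only [map_smul, LinearMap.smul_apply, hx]
    | basis i =>
      by_cases h : ∃ j, j < i ∧ IsLeast (m.support : Set ι) j
      · obtain ⟨j, hji, hj⟩ := h
        obtain ⟨m, rfl⟩ := exists_eq_add_single hj
        rw [map_add, Finsupp.degree_single] at hm
        have hmk : monomial m (1 : R) ∈ degreeLT ι R (n + 1) := monomial_mem_degreeLT (by omega) 1
        have hsub := pbwApprox_sub_mem b t n (n + 1) (b i) _ hmk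
        rw [linForm_basis] at hsub
        rw [pbwApprox_succ_of_lt b t (n + 1) i j m hji hj, pbwApprox_succ_of_lt b t n i j m hji hj,
          ih _ _ hmk, ih _ _ hmk, ih _ _ hsub]
      · rw [pbwApprox_succ_of_not b t _ i m h, pbwApprox_succ_of_not b t _ i m h]

lemma pbwApprox_eq (t : R) {n k : ℕ} (hnk : n ≤ k) (x : L) {p : MvPolynomial ι R}
    (hp : p ∈ degreeLT ι R (n + 1)) : pbwApprox b t k x p = pbwApprox b t n x p := by
  induction k, hnk using Nat.le_induction with
  | base => rfl
  | succ k hk ih => rw [pbwApprox_succ_eq b t k x p (degreeLT_mono (by omega) hp), ih]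

/-- The Poincaré–Birkhoff–Witt action of a Lie algebra with the bracket scaled by `t` on the
polynomials in an ordered basis. -/
def pbwAction (t : R) : L →ₗ[R] MvPolynomial ι R →ₗ[R] MvPolynomial ι R :=
  b.constr R fun i => (basisMonomials ι R).constr R fun m =>
    pbwApprox b t m.degree (b i) (monomial m 1)

lemma pbwAction_eq_pbwApprox (t : R) (n : ℕ) (x : L) {p : MvPolynomial ι R}
    (hp : p ∈ degreeLT ι R (n + 1)) : pbwAction b t x p = pbwApprox b t n x p := by
  refine sub_eq_zero.1 ((Submodule.mem_bot R).1 (map_mem_of_degreeLT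
    (pbwAction b t x - pbwApprox b t n x) ⊥ (fun m hm => ?_) hp))
  rw [Submodule.mem_bot, LinearMap.sub_apply, sub_eq_zero]
  induction x using basis_induction b with
  | zero => simp
  | add x y hx hy => simp only [map_add, LinearMap.add_apply, hx, hy]
  | smul r x hx => simp only [map_smul, LinearMap.smul_apply, hx]
  | basis i =>
    rw [pbwApprox_eq b t (Nat.le_of_lt_succ hm) (b i) (monomial_mem_degreeLT (Nat.lt_succ_self _) 1)]
    rw [pbwAction, Module.Basis.constr_basis, constr_basisMonomials]

lemma pbwAction_sub_mem (t : R) {n : ℕ} (x : L) {p : MvPolynomial ι R} (hp : p ∈ degreeLT ι R n) :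
    pbwAction b t x p - linForm b x * p ∈ degreeLT ι R n := by
  rw [pbwAction_eq_pbwApprox b t n x (degreeLT_mono n.le_succ hp)]
  exact pbwApprox_sub_mem b t n n x p hp

lemma pbwAction_of_le (t : R) (i : ι) (m : ι →₀ ℕ) (h : ∀ j ∈ m.support, i ≤ j) :
    pbwAction b t (b i) (monomial m 1) = X i * monomial m 1 := by
  -- Level `m.degree` would suffice, but a successor level is needed for the recursive clause to
  -- apply.
  rw [pbwAction_eq_pbwApprox b t (m.degree + 1) _ (monomial_mem_degreeLT (by omega) 1),
    pbwApprox_succ_of_not]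
  rintro ⟨j, hji, hj, -⟩
  exact absurd hji (not_lt.2 (h j hj))

lemma mem_support_add_single {m : ι →₀ ℕ} {i j : ι} :
    j ∈ (m + Finsupp.single i 1).support ↔ j ∈ m.support ∨ j = i := by
  simp only [Finsupp.mem_support_iff, Finsupp.add_apply, Finsupp.single_apply]
  grind

lemma pbwAction_of_lt (t : R) (i j : ι) (m : ι →₀ ℕ) (hji : j < i) (h : ∀ k ∈ m.support, j ≤ k) :
    pbwAction b t (b i) (X j * monomial m 1) =
      pbwAction b t (b j) (pbwAction b t (b i) (monomial m 1)) +
        t • pbwAction b t ⁅b i, b j⁆ (monomial m 1) := by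
  have hj : IsLeast ((m + Finsupp.single j 1).support : Set ι) j := by
    refine ⟨mem_support_add_single.2 (Or.inr rfl), fun k hk => ?_⟩
    rcases mem_support_add_single.1 hk with hk | rfl
    exacts [h k hk, le_rfl]
  have hm : monomial m (1 : R) ∈ degreeLT ι R (m.degree + 1) :=
    monomial_mem_degreeLT (by omega) 1
  have hsub := pbwAction_sub_mem b t (b i) hm
  rw [linForm_basis] at hsub
  have hX : pbwAction b t (b j) (X i * monomial m 1) = X j * (X i * monomial m 1) := by
    rw [X_mul_monomial_one i m, pbwAction_of_le]
    intro k hk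
    rcases mem_support_add_single.1 hk with hk | rfl
    exacts [h k hk, hji.le]
  rw [X_mul_monomial_one, pbwAction_eq_pbwApprox b t (m.degree + 1) (b i)
      (monomial_mem_degreeLT (by rw [map_add, Finsupp.degree_single]; omega) 1),
    pbwApprox_succ_of_lt b t _ i j m hji hj, ← pbwAction_eq_pbwApprox b t _ (b i) hm,
    ← pbwAction_eq_pbwApprox b t _ (b j) hsub, ← pbwAction_eq_pbwApprox b t _ _ hm,
    map_sub, hX, ← X_mul_monomial_one]
  ring

/-- The failure of `pbwAction` to be a representation. -/
def pbwDefect (t : R) (x y : L) : MvPolynomial ι R →ₗ[R] MvPolynomial ι R :=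
  pbwAction b t x ∘ₗ pbwAction b t y - pbwAction b t y ∘ₗ pbwAction b t x -
    t • pbwAction b t ⁅x, y⁆

lemma pbwDefect_apply (t : R) (x y : L) (p : MvPolynomial ι R) :
    pbwDefect b t x y p = pbwAction b t x (pbwAction b t y p) -
      pbwAction b t y (pbwAction b t x p) - t • pbwAction b t ⁅x, y⁆ p := rfl

lemma pbwDefect_swap (t : R) (x y : L) (p : MvPolynomial ι R) :
    pbwDefect b t x y p = - pbwDefect b t y x p := by
  rw [pbwDefect_apply, pbwDefect_apply, ← lie_skew x y]
  simp only [map_neg, LinearMap.neg_apply, smul_neg]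
  abel

lemma pbwDefect_eq_zero_of_basis (t : R) (p : MvPolynomial ι R)
    (h : ∀ i j, j < i → pbwDefect b t (b i) (b j) p = 0) (x y : L) : pbwDefect b t x y p = 0 := by
  induction x using basis_induction b with
  | zero => simp [pbwDefect_apply]
  | add x x' hx hx' =>
    rw [pbwDefect_apply] at *
    simp only [map_add, LinearMap.add_apply, add_lie, smul_add]
    linear_combination (norm := module) hx + hx'
  | smul r x hx =>
    rw [pbwDefect_apply] at *
    simp only [map_smul, LinearMap.smul_apply, smul_lie, smul_comm t r, ← smul_sub, hx, smul_zero]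
  | basis i =>
    induction y using basis_induction b with
    | zero => simp [pbwDefect_apply]
    | add x x' hx hx' =>
      rw [pbwDefect_apply] at *
      simp only [map_add, LinearMap.add_apply, lie_add, smul_add]
      linear_combination (norm := module) hx + hx'
    | smul r x hx =>
      rw [pbwDefect_apply] at *
      simp only [map_smul, LinearMap.smul_apply, lie_smul, smul_comm t r, ← smul_sub, hx, smul_zero]
    | basis j =>
      rcases lt_trichotomy i j with hij | rfl | hij
      · rw [pbwDefect_swap, h j i hij, neg_zero]
      · simp [pbwDefect_apply]
      · exact h i j hij

/-- Here $b_j\cdot m=X_jm$, so the commutation relation is the one built into the recursion. -/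
lemma pbwDefect_of_le (t : R) (i j : ι) (m : ι →₀ ℕ) (hji : j < i) (h : ∀ k ∈ m.support, j ≤ k) :
    pbwDefect b t (b i) (b j) (monomial m 1) = 0 := by
  rw [pbwDefect_apply, pbwAction_of_le b t j m h, pbwAction_of_lt b t i j m hji h]
  abel

/-- Induction on degree. The remaining case is $k<j<i$ with $k$ the least letter: write the monomial
as $b_k\cdot m$ and move $b_k$ to the left through $b_i$ and $b_j$. Relations on $m$ hold by
induction, and the Jacobi identity cancels the bracket terms. -/
lemma pbwDefect_monomial (t : R) (n : ℕ) : ∀ (m : ι →₀ ℕ), m.degree < n → ∀ x y : L,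
    pbwDefect b t x y (monomial m 1) = 0 := by
  induction n with
  | zero => intro m hm; omega
  | succ n ih =>
    intro m hm x y
    refine pbwDefect_eq_zero_of_basis b t _ (fun i j hji => ?_) x y
    have ih' : ∀ (x y : L) (p : MvPolynomial ι R), p ∈ degreeLT ι R n →
        pbwDefect b t x y p = 0 := fun x y p hp =>
      (Submodule.mem_bot R).1 (map_mem_of_degreeLT (pbwDefect b t x y) ⊥
        (fun m hm => (Submodule.mem_bot R).2 (ih m hm x y)) hp)
    by_cases h : ∀ k ∈ m.support, j ≤ k
    · exact pbwDefect_of_le b t i j m hji h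
    push Not at h
    obtain ⟨k₀, hk₀, hk₀j⟩ := h
    have hne : m.support.Nonempty := ⟨k₀, hk₀⟩
    obtain ⟨k, hk⟩ : ∃ k, IsLeast (m.support : Set ι) k :=
      ⟨_, Finset.isLeast_min' m.support hne⟩
    have hkj : k < j := (hk.2 hk₀).trans_lt hk₀j
    obtain ⟨m, rfl⟩ := exists_eq_add_single hk
    rw [map_add, Finsupp.degree_single] at hm
    have hkm : ∀ l ∈ m.support, k ≤ l := fun l hl =>
      hk.2 (mem_support_add_single.2 (Or.inl hl))
    have hm1 : monomial m (1 : R) ∈ degreeLT ι R (m.degree + 1) :=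
      monomial_mem_degreeLT (by omega) 1
    have hmn : monomial m (1 : R) ∈ degreeLT ι R n := monomial_mem_degreeLT (by omega) 1
    have hk1 : pbwAction b t (b k) (monomial m 1) = X k * monomial m 1 :=
      pbwAction_of_le b t k m hkm
    -- the basis element `b k` commutes past every larger one on `b j • m`
    have step : ∀ i j, k < i → k < j →
        pbwDefect b t (b i) (b k) (pbwAction b t (b j) (monomial m 1)) = 0 := by
      intro i j hki hkj
      -- Split $b_j\cdot m=X_jm+w$: the degree of $w$ is at most $\deg m$, so induction applies to
      -- it, and $k$ is at most every letter of $X_jm$.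
      have hw := pbwAction_sub_mem b t (b j) hm1
      rw [linForm_basis] at hw
      rw [← sub_add_cancel (pbwAction b t (b j) (monomial m 1)) (X j * monomial m 1), map_add,
        ih' _ _ _ (degreeLT_mono (by omega) hw), X_mul_monomial_one, pbwDefect_of_le b t i k _ hki,
        add_zero]
      intro l hl
      rcases mem_support_add_single.1 hl with hl | rfl
      exacts [hkm l hl, hkj.le]
    have e1 := step i j (hkj.trans hji) hkj
    have e2 := step j i hkj (hkj.trans hji)
    have e3 := ih' (b i) (b j) _ hmn
    have e4 := ih' (b i) (b k) _ hmn
    have e5 := ih' (b j) (b k) _ hmn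
    have e6 := ih' ⁅b i, b k⁆ (b j) _ hmn
    have e7 := ih' (b i) ⁅b j, b k⁆ _ hmn
    have e8 := ih' ⁅b i, b j⁆ (b k) _ hmn
    have jac : ⁅⁅b i, b j⁆, b k⁆ = ⁅⁅b i, b k⁆, b j⁆ + ⁅b i, ⁅b j, b k⁆⁆ := by
      rw [lie_lie, ← lie_skew ⁅b i, b k⁆ (b j)]
      abel
    rw [pbwDefect_apply] at e1 e2 e3 e4 e5 e6 e7 e8
    have f4 := sub_eq_zero.1 e4
    have f5 := sub_eq_zero.1 e5
    rw [sub_eq_iff_eq_add] at f4 f5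
    have g3 := congrArg (pbwAction b t (b k)) e3
    simp only [map_sub, map_smul, map_zero] at g3
    rw [← X_mul_monomial_one, ← hk1, pbwDefect_apply, f4, f5]
    simp only [map_add, map_smul]
    rw [jac, map_add, LinearMap.add_apply] at e8
    linear_combination (norm := module) e1 - e2 + g3 + t • e6 + t • e7 - t • e8

/-- The Poincaré–Birkhoff–Witt action is a representation. -/
theorem pbwAction_lie (t : R) (x y : L) :
    pbwAction b t x * pbwAction b t y - pbwAction b t y * pbwAction b t x =
      t • pbwAction b t ⁅x, y⁆ := by
  rw [← sub_eq_zero]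
  refine (basisMonomials ι R).ext fun m => ?_
  rw [coe_basisMonomials]
  exact pbwDefect_monomial b t _ m (Nat.lt_succ_self _) x y

end Representation

/-! ### Injectivity of the PBW map -/

section Injectivity

open MvPolynomial

variable {𝔤 : Type u} [LieRing 𝔤] [LieAlgebra ℂ 𝔤] {ι : Type w} (X : Module.Basis ι ℂ 𝔤)

/-- The representation of `U_t(𝔤)` on polynomials extending `pbwAction`. -/
def pbwRep [LinearOrder ι] (t : ℂ) : Ut 𝔤 t →ₐ[ℂ] Module.End ℂ (MvPolynomial ι ℂ) :=
  RingQuot.liftAlgHom ℂ ⟨TensorAlgebra.lift ℂ (pbwAction X t), by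
    rintro _ _ ⟨x, y⟩
    have h := pbwAction_lie X t x y
    simpa using h⟩

lemma pbwRep_ι [LinearOrder ι] (t : ℂ) (x : 𝔤) : pbwRep X t (Ut.ι 𝔤 t x) = pbwAction X t x := by
  simp [pbwRep, Ut.ι]

lemma linForm_prod_mem_degreeLT (l : List 𝔤) :
    (l.map (linForm X)).prod ∈ degreeLT ι ℂ (l.length + 1) := by
  induction l with
  | nil => exact monomial_mem_degreeLT (by simp) 1
  | cons x l ih =>
    rw [List.map_cons, List.prod_cons]
    exact linForm_mul_mem_degreeLT X x ih

lemma pbwRep_prod_sub_mem [LinearOrder ι] (t : ℂ) (l : List 𝔤) :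
    pbwRep X t (l.map (Ut.ι 𝔤 t)).prod 1 - (l.map (linForm X)).prod ∈ degreeLT ι ℂ l.length := by
  induction l with
  | nil => simp
  | cons x l ih =>
    have hp := add_mem (degreeLT_mono (Nat.le_succ _) ih) (linForm_prod_mem_degreeLT X l)
    rw [sub_add_cancel] at hp
    have h1 := pbwAction_sub_mem X t x hp
    have h2 := linForm_mul_mem_degreeLT X x ih
    rw [List.map_cons, List.map_cons, List.prod_cons, List.prod_cons, map_mul, pbwRep_ι,
      Module.End.mul_apply]
    have := add_mem h1 h2
    rwa [mul_sub, sub_add_sub_cancel] at this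

/-- The list `l` with its entries permuted by `σ`. -/
def permute {α : Type*} (l : List α) (σ : Equiv.Perm (Fin l.length)) : List α :=
  List.ofFn (l.get ∘ σ)

lemma permute_perm {α : Type*} (l : List α) (σ : Equiv.Perm (Fin l.length)) :
    List.Perm (permute l σ) l := by
  simpa only [permute, List.ofFn_get] using Equiv.Perm.ofFn_comp_perm σ l.get

lemma inv_factorial_smul_sum_const {M : Type*} [AddCommGroup M] [Module ℂ M] (k : ℕ) (x : M) :
    (k ! : ℂ)⁻¹ • ∑ _σ : Equiv.Perm (Fin k), x = x := by
  have hk : (k ! : ℂ) ≠ 0 := Nat.cast_ne_zero.2 k.factorial_ne_zero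
  rw [Finset.sum_const, Finset.card_univ, Fintype.card_perm, Fintype.card_fin,
    ← Nat.cast_smul_eq_nsmul ℂ, smul_smul, inv_mul_cancel₀ hk, one_smul]

lemma IPBW_list_prod (t : ℂ) (l : List 𝔤) :
    IPBW 𝔤 t (l.map (SymmetricAlgebra.ι ℂ 𝔤)).prod =
      (l.length ! : ℂ)⁻¹ • ∑ σ : Equiv.Perm (Fin l.length),
        ((permute l σ).map (Ut.ι 𝔤 t)).prod := by
  have h : (l.map (SymmetricAlgebra.ι ℂ 𝔤)).prod = ∏ i, SymmetricAlgebra.ι ℂ 𝔤 (l.get i) := by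
    conv_lhs => rw [← List.ofFn_get l, List.map_ofFn, List.prod_ofFn]
    rfl
  rw [h, IPBW_prod]
  simp only [permute, List.map_ofFn]
  rfl

/-- All reorderings of a word have the same leading term, since linear forms commute; averaging
preserves it. -/
lemma pbwRep_IPBW_sub_mem [LinearOrder ι] (t : ℂ) (l : List 𝔤) :
    pbwRep X t (IPBW 𝔤 t (l.map (SymmetricAlgebra.ι ℂ 𝔤)).prod) 1 - (l.map (linForm X)).prod ∈
      degreeLT ι ℂ l.length := by
  have key : ∀ σ : Equiv.Perm (Fin l.length),
      pbwRep X t ((permute l σ).map (Ut.ι 𝔤 t)).prod 1 - (l.map (linForm X)).prod ∈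
        degreeLT ι ℂ l.length := by
    intro σ
    have h := pbwRep_prod_sub_mem X t (permute l σ)
    rwa [(permute_perm l σ).length_eq, ((permute_perm l σ).map (linForm X)).prod_eq] at h
  have e := inv_factorial_smul_sum_const l.length (l.map (linForm X)).prod
  rw [← e, IPBW_list_prod, map_smul, map_sum, LinearMap.smul_apply, LinearMap.sum_apply,
    ← smul_sub, ← Finset.sum_sub_distrib]
  exact Submodule.smul_mem _ _ (sum_mem fun σ _ => key σ)

lemma exists_monomial_eq_prod (m : ι →₀ ℕ) :
    ∃ l : List ι, l.length = m.degree ∧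
      monomial m (1 : ℂ) = (l.map (MvPolynomial.X : ι → MvPolynomial ι ℂ)).prod := by
  refine ⟨(Finsupp.toMultiset m).toList, ?_, ?_⟩
  · rw [Multiset.length_toList, Finsupp.card_toMultiset, Finsupp.degree_apply]
    rfl
  · rw [← Multiset.prod_coe, ← Multiset.map_coe, Multiset.coe_toList, Finsupp.toMultiset_map,
      Finsupp.prod_toMultiset, monomial_eq, C_1, one_mul, Finsupp.prod_mapDomain_index] <;>
    simp [pow_add]

lemma equivMvPolynomial_symm_prod (l : List ι) :
    (SymmetricAlgebra.equivMvPolynomial X).symm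
      (l.map (MvPolynomial.X : ι → MvPolynomial ι ℂ)).prod =
      ((l.map X).map (SymmetricAlgebra.ι ℂ 𝔤)).prod := by
  rw [AlgEquiv.symm_apply_eq, map_list_prod, List.map_map, List.map_map]
  congr 2
  funext i
  simp [SymmetricAlgebra.equivMvPolynomial_ι_apply]

theorem IPBW_injective (t : ℂ) : Function.Injective (IPBW 𝔤 t) := by
  obtain ⟨ι, ⟨X⟩⟩ : ∃ ι : Type u, Nonempty (Module.Basis ι ℂ 𝔤) :=
    ⟨_, ⟨Module.Basis.ofVectorSpace ℂ 𝔤⟩⟩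
  classical
  let : LinearOrder ι := linearOrderOfSTO WellOrderingRel
  let e := SymmetricAlgebra.equivMvPolynomial X
  let F : MvPolynomial ι ℂ →ₗ[ℂ] MvPolynomial ι ℂ :=
    LinearMap.applyₗ 1 ∘ₗ (pbwRep X t).toLinearMap ∘ₗ IPBW 𝔤 t ∘ₗ e.symm.toLinearMap
  have hF : ∀ (n : ℕ) (p : MvPolynomial ι ℂ), p ∈ degreeLT ι ℂ (n + 1) →
      F p - p ∈ degreeLT ι ℂ n := by
    intro n p hp
    refine map_mem_of_degreeLT (F - LinearMap.id) _ (fun m hm => ?_) hp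
    obtain ⟨l, hl, hml⟩ := exists_monomial_eq_prod m
    have h := pbwRep_IPBW_sub_mem X t (l.map X)
    have hX : ((l.map X).map (linForm X)).prod = monomial m 1 := by
      rw [hml, List.map_map]
      congr 2
      funext i
      exact linForm_basis X i
    rw [hX, ← equivMvPolynomial_symm_prod, ← hml, List.length_map, hl] at h
    exact degreeLT_mono (Nat.le_of_lt_succ hm) h
  -- If $F(p)=0$, then $p=-(F(p)-p)$ lies one degree lower; descend to degree below 0.
  have hF0 : ∀ (n : ℕ) (p : MvPolynomial ι ℂ), p ∈ degreeLT ι ℂ n → F p = 0 → p = 0 := by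
    intro n
    induction n with
    | zero => exact fun p hp _ => degreeLT_zero hp
    | succ n ih =>
      intro p hp h0
      have h := hF n p hp
      rw [h0, zero_sub, neg_mem_iff] at h
      exact ih p h h0
  rw [← LinearMap.ker_eq_bot, LinearMap.ker_eq_bot']
  intro a ha
  obtain ⟨n, hn⟩ := exists_mem_degreeLT (e a)
  have : e a = 0 := hF0 n _ hn (by simp [F, ha])
  simpa using this

end Injectivity

/-! ### The Poisson bracket as an antisymmetric biderivation -/

section PoissonBracket

variable {𝔤 : Type u} [LieRing 𝔤] [LieAlgebra ℂ 𝔤] {ι : Type w}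
  (X : Module.Basis ι ℂ 𝔤)

lemma partialS_mul (i : ι) (a b : SymmetricAlgebra ℂ 𝔤) :
    partialS X i (a * b) = a * partialS X i b + partialS X i a * b := by
  simp only [partialS, LinearMap.comp_apply, AlgEquiv.toLinearMap_apply, map_mul,
    Derivation.coeFn_coe, Derivation.leibniz, smul_eq_mul, map_add,
    AlgEquiv.symm_apply_apply]
  ring

lemma partialS_ι [DecidableEq ι] (i j : ι) :
    partialS X i (SymmetricAlgebra.ι ℂ 𝔤 (X j)) = if i = j then 1 else 0 := by
  simp only [partialS, LinearMap.comp_apply, AlgEquiv.toLinearMap_apply,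
    Derivation.coeFn_coe,
    SymmetricAlgebra.equivMvPolynomial_ι_apply, MvPolynomial.pderiv_X, Pi.single_apply]
  split_ifs <;> simp_all

variable [Fintype ι]

lemma poissonS_apply (a b : SymmetricAlgebra ℂ 𝔤) :
    poissonS X a b = ∑ i, ∑ j,
      SymmetricAlgebra.ι ℂ 𝔤 ⁅X i, X j⁆ * partialS X i a * partialS X j b := by
  simp only [poissonS, LinearMap.mk₂_apply]
  refine Finset.sum_congr rfl fun i _ => Finset.sum_congr rfl fun j _ => ?_
  conv_rhs => rw [← X.sum_repr ⁅X i, X j⁆, map_sum, Finset.sum_mul, Finset.sum_mul]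
  refine Finset.sum_congr rfl fun k _ => ?_
  rw [map_smul, smul_mul_assoc, smul_mul_assoc]

lemma poissonS_swap (a b : SymmetricAlgebra ℂ 𝔤) : poissonS X a b = - poissonS X b a := by
  rw [poissonS_apply, poissonS_apply, Finset.sum_comm, ← Finset.sum_neg_distrib]
  refine Finset.sum_congr rfl fun i _ => ?_
  rw [← Finset.sum_neg_distrib]
  refine Finset.sum_congr rfl fun j _ => ?_
  rw [← lie_skew (X j) (X i), map_neg]
  ring

lemma poissonS_mul_right (a b c : SymmetricAlgebra ℂ 𝔤) :
    poissonS X a (b * c) = b * poissonS X a c + poissonS X a b * c := by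
  simp only [poissonS_apply, Finset.mul_sum, Finset.sum_mul, ← Finset.sum_add_distrib,
    partialS_mul]
  refine Finset.sum_congr rfl fun i _ => Finset.sum_congr rfl fun j _ => ?_
  ring

lemma poissonS_mul_left (a b c : SymmetricAlgebra ℂ 𝔤) :
    poissonS X (a * b) c = a * poissonS X b c + poissonS X a c * b := by
  rw [poissonS_swap, poissonS_mul_right, poissonS_swap X c b, poissonS_swap X c a]
  ring

lemma poissonS_one_left (a : SymmetricAlgebra ℂ 𝔤) : poissonS X 1 a = 0 := by
  have h := poissonS_mul_left X 1 1 a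
  simpa using h

lemma poissonS_one_right (a : SymmetricAlgebra ℂ 𝔤) : poissonS X a 1 = 0 := by
  rw [poissonS_swap, poissonS_one_left, neg_zero]

lemma poissonS_ι (x y : 𝔤) :
    poissonS X (SymmetricAlgebra.ι ℂ 𝔤 x) (SymmetricAlgebra.ι ℂ 𝔤 y) =
      SymmetricAlgebra.ι ℂ 𝔤 ⁅x, y⁆ := by
  classical
  induction x using basis_induction X with
  | zero => simp
  | add x x' hx hx' => simp only [map_add, LinearMap.add_apply, add_lie, hx, hx']
  | smul r x hx => simp only [map_smul, LinearMap.smul_apply, smul_lie, hx]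
  | basis i =>
    induction y using basis_induction X with
    | zero => simp
    | add x x' hx hx' => simp only [map_add, lie_add, hx, hx']
    | smul r x hx => simp only [map_smul, lie_smul, hx]
    | basis j => simp [poissonS_apply, partialS_ι]

end PoissonBracket

/-! ### Normal forms of words, their first-order terms, and surjectivity -/

section WordExpansion

variable {𝔤 : Type u} [LieRing 𝔤] [LieAlgebra ℂ 𝔤]

/-- The product of a list of vectors in the tensor algebra. -/
def tensorWord (l : List 𝔤) : TensorAlgebra ℂ 𝔤 := (l.map (TensorAlgebra.ι ℂ)).prod

/-- The product of a list of vectors in the symmetric algebra. -/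
def symWord (l : List 𝔤) : SymmetricAlgebra ℂ 𝔤 := (l.map (SymmetricAlgebra.ι ℂ 𝔤)).prod

@[simp] lemma tensorWord_nil : tensorWord ([] : List 𝔤) = 1 := rfl

@[simp] lemma tensorWord_cons (x : 𝔤) (l : List 𝔤) :
    tensorWord (x :: l) = TensorAlgebra.ι ℂ x * tensorWord l := by
  simp [tensorWord]

lemma tensorWord_append (l l' : List 𝔤) :
    tensorWord (l ++ l') = tensorWord l * tensorWord l' := by
  simp [tensorWord]

@[simp] lemma symWord_nil : symWord ([] : List 𝔤) = 1 := rfl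

@[simp] lemma symWord_cons (x : 𝔤) (l : List 𝔤) :
    symWord (x :: l) = SymmetricAlgebra.ι ℂ 𝔤 x * symWord l := by
  simp [symWord]

lemma symWord_append (l l' : List 𝔤) : symWord (l ++ l') = symWord l * symWord l' := by
  simp [symWord]

lemma symWord_perm {l l' : List 𝔤} (h : l.Perm l') : symWord l = symWord l' :=
  (h.map _).prod_eq

lemma symWord_reverse (l : List 𝔤) : symWord l.reverse = symWord l :=
  symWord_perm l.reverse_perm

lemma algHom_tensorWord (l : List 𝔤) : SymmetricAlgebra.algHom ℂ 𝔤 (tensorWord l) = symWord l := by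
  rw [tensorWord, symWord, map_list_prod, List.map_map]
  rfl

/-- The span of the words of length less than `n` in the tensor algebra. -/
def wordLT (𝔤 : Type u) [LieRing 𝔤] [LieAlgebra ℂ 𝔤] (n : ℕ) :
    Submodule ℂ (TensorAlgebra ℂ 𝔤) :=
  Submodule.span ℂ (tensorWord '' {l : List 𝔤 | l.length < n})

lemma tensorWord_mem_wordLT {n : ℕ} {l : List 𝔤} (h : l.length < n) :
    tensorWord l ∈ wordLT 𝔤 n :=
  Submodule.subset_span ⟨l, h, rfl⟩

lemma ι_mul_mem_wordLT (x : 𝔤) {n : ℕ} {u : TensorAlgebra ℂ 𝔤} (hu : u ∈ wordLT 𝔤 n) :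
    TensorAlgebra.ι ℂ x * u ∈ wordLT 𝔤 (n + 1) := by
  induction hu using Submodule.span_induction with
  | mem u h =>
    obtain ⟨l, hl, rfl⟩ := h
    rw [← tensorWord_cons]
    exact tensorWord_mem_wordLT (Nat.succ_lt_succ hl)
  | zero => simp
  | add u v _ _ hu hv => rw [mul_add]; exact add_mem hu hv
  | smul c u _ hu => rw [mul_smul_comm]; exact Submodule.smul_mem _ _ hu

section FirstOrder

variable {ι : Type w} [Fintype ι] (X : Module.Basis ι ℂ 𝔤)

/-- The coefficient of `t` in the normal form of a word in `U_t(𝔤)`. -/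
def firstOrder : List 𝔤 → SymmetricAlgebra ℂ 𝔤
  | [] => 0
  | x :: l => SymmetricAlgebra.ι ℂ 𝔤 x * firstOrder l +
      (2⁻¹ : ℂ) • poissonS X (SymmetricAlgebra.ι ℂ 𝔤 x) (symWord l)

/-- Pairs of letters lie within `l`, within `l'`, or across; by the biderivation property the
crossing pairs sum to the bracket. -/
lemma firstOrder_append (l l' : List 𝔤) :
    firstOrder X (l ++ l') = symWord l * firstOrder X l' + firstOrder X l * symWord l' +
      (2⁻¹ : ℂ) • poissonS X (symWord l) (symWord l') := by
  induction l with
  | nil => simp [firstOrder, poissonS_one_left]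
  | cons x l ih =>
    simp only [List.cons_append, firstOrder, ih, symWord_append, symWord_cons, poissonS_mul_left,
      poissonS_mul_right, Algebra.smul_def]
    ring

lemma firstOrder_reverse (l : List 𝔤) : firstOrder X l.reverse = - firstOrder X l := by
  induction l with
  | nil => simp [firstOrder]
  | cons x l ih =>
    rw [List.reverse_cons, firstOrder_append, ih, symWord_reverse]
    simp only [firstOrder, symWord_cons, symWord_nil, mul_one, poissonS_one_right, smul_zero,
      mul_zero, zero_add, add_zero]
    rw [poissonS_swap, smul_neg]
    ring

lemma permute_mul_revPerm {α : Type*} (l : List α) (σ : Equiv.Perm (Fin l.length)) :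
    permute l (σ * Fin.revPerm) = (permute l σ).reverse := by
  refine List.ext_getElem (by simp [permute]) fun i h₁ h₂ => ?_
  rw [List.getElem_reverse]
  simp only [permute, List.getElem_ofFn, List.length_ofFn, Function.comp_apply,
    Equiv.Perm.mul_apply, Fin.revPerm_apply]
  congr 2
  ext
  simp [Fin.rev]
  omega

/-- Composing with the order reversal permutes the summands and flips each sign. -/
lemma sum_firstOrder_permute (l : List 𝔤) :
    ∑ σ : Equiv.Perm (Fin l.length), firstOrder X (permute l σ) = 0 := by
  have h : ∑ σ : Equiv.Perm (Fin l.length), firstOrder X (permute l σ) =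
      - ∑ σ : Equiv.Perm (Fin l.length), firstOrder X (permute l σ) := by
    rw [← Finset.sum_neg_distrib]
    refine (Fintype.sum_equiv (Equiv.mulRight Fin.revPerm) _ _ fun σ => ?_).symm
    rw [Equiv.coe_mulRight, permute_mul_revPerm, firstOrder_reverse]
  rw [eq_neg_iff_add_eq_zero, ← two_smul ℂ] at h
  exact (smul_eq_zero.1 h).resolve_left two_ne_zero

/-- Permuting the letters of a word changes its image in `U_t(𝔤)` by `t` times a combination of
shorter words that does not depend on `t`. -/
lemma exists_perm_correction {l l' : List 𝔤} (h : l.Perm l') :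
    ∃ d ∈ wordLT 𝔤 l.length,
      SymmetricAlgebra.algHom ℂ 𝔤 d = firstOrder X l - firstOrder X l' ∧
      ∀ t : ℂ, RingQuot.mkAlgHom ℂ (URel 𝔤 t) (tensorWord l) =
        RingQuot.mkAlgHom ℂ (URel 𝔤 t) (tensorWord l') +
          t • RingQuot.mkAlgHom ℂ (URel 𝔤 t) d := by
  induction h with
  | nil => exact ⟨0, zero_mem _, by simp, by simp⟩
  | cons x hl ih =>
    obtain ⟨d, hd, hE, ht⟩ := ih
    refine ⟨TensorAlgebra.ι ℂ x * d, ι_mul_mem_wordLT x hd, ?_, fun t => ?_⟩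
    · rw [map_mul, hE, firstOrder, firstOrder, symWord_perm hl]
      change SymmetricAlgebra.ι ℂ 𝔤 x * _ = _
      ring
    · rw [tensorWord_cons, tensorWord_cons, map_mul, ht t, map_mul, map_mul, mul_add,
        mul_smul_comm]
  | swap x y l =>
    -- The two orders contribute $\frac12[y,x]$ and $\frac12[x,y]$, whose difference is the full
    -- bracket $[y,x]$.
    refine ⟨tensorWord (⁅y, x⁆ :: l), tensorWord_mem_wordLT (by simp), ?_, fun t => ?_⟩
    · rw [algHom_tensorWord]
      simp only [firstOrder, symWord_cons, poissonS_mul_right, poissonS_ι]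
      rw [← lie_skew y x, map_neg]
      simp only [Algebra.smul_def]
      have h2 : algebraMap ℂ (SymmetricAlgebra ℂ 𝔤) 2⁻¹ * 2 = 1 := by
        rw [← map_ofNat (algebraMap ℂ (SymmetricAlgebra ℂ 𝔤)) 2, ← map_mul]
        simp
      linear_combination (SymmetricAlgebra.ι ℂ 𝔤 ⁅x, y⁆ * symWord l) * h2
    · have h := RingQuot.mkAlgHom_rel ℂ (URel.lie (t := t) y x)
      rw [map_sub, map_smul, sub_eq_iff_eq_add'] at h
      simp only [tensorWord_cons, ← mul_assoc]
      rw [map_mul, h, add_mul, smul_mul_assoc, map_mul _ (_ * _) (tensorWord l),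
        map_mul _ _ (tensorWord l)]
  | trans h₁ _ ih₁ ih₂ =>
    obtain ⟨d₁, hd₁, hE₁, ht₁⟩ := ih₁
    obtain ⟨d₂, hd₂, hE₂, ht₂⟩ := ih₂
    refine ⟨d₁ + d₂, add_mem hd₁ (h₁.length_eq ▸ hd₂), ?_, fun t => ?_⟩
    · rw [map_add, hE₁, hE₂]
      abel
    · rw [ht₁, ht₂, map_add, smul_add]
      abel

end FirstOrder

/-- The polynomial `q` in a formal variable `t` is the preimage under `I_PBW` of the image of the
tensor `u` in `U_t(𝔤)`, for every `t`. -/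
def IsNormalForm (u : TensorAlgebra ℂ 𝔤) (q : Polynomial (SymmetricAlgebra ℂ 𝔤)) : Prop :=
  ∀ t : ℂ, RingQuot.mkAlgHom ℂ (URel 𝔤 t) u =
    IPBW 𝔤 t (q.eval (algebraMap ℂ (SymmetricAlgebra ℂ 𝔤) t))

lemma IsNormalForm.add {u v : TensorAlgebra ℂ 𝔤} {p q : Polynomial (SymmetricAlgebra ℂ 𝔤)}
    (hu : IsNormalForm u p) (hv : IsNormalForm v q) : IsNormalForm (u + v) (p + q) := fun t => by
  rw [map_add, hu t, hv t, Polynomial.eval_add, map_add]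

lemma IsNormalForm.smul {u : TensorAlgebra ℂ 𝔤} {p : Polynomial (SymmetricAlgebra ℂ 𝔤)} (c : ℂ)
    (hu : IsNormalForm u p) : IsNormalForm (c • u) (c • p) := fun t => by
  rw [map_smul, hu t, Polynomial.eval_smul, map_smul]

lemma IsNormalForm.sum {κ : Type*} (s : Finset κ) {u : κ → TensorAlgebra ℂ 𝔤}
    {q : κ → Polynomial (SymmetricAlgebra ℂ 𝔤)} (h : ∀ k, IsNormalForm (u k) (q k)) :
    IsNormalForm (∑ k ∈ s, u k) (∑ k ∈ s, q k) := fun t => by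
  rw [map_sum, Polynomial.eval_finsetSum, map_sum]
  exact Finset.sum_congr rfl fun k _ => h k t

lemma mkAlgHom_tensorWord (t : ℂ) (l : List 𝔤) :
    RingQuot.mkAlgHom ℂ (URel 𝔤 t) (tensorWord l) = (l.map (Ut.ι 𝔤 t)).prod := by
  rw [tensorWord, map_list_prod, List.map_map]
  rfl

lemma exists_isNormalForm_of_mem {n : ℕ}
    (h : ∀ l : List 𝔤, l.length < n → ∃ q, IsNormalForm (tensorWord l) q ∧ q.coeff 0 = symWord l)
    {u : TensorAlgebra ℂ 𝔤} (hu : u ∈ wordLT 𝔤 n) :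
    ∃ q, IsNormalForm u q ∧ q.coeff 0 = SymmetricAlgebra.algHom ℂ 𝔤 u := by
  induction hu using Submodule.span_induction with
  | mem u hu =>
    obtain ⟨l, hl, rfl⟩ := hu
    rw [algHom_tensorWord]
    exact h l hl
  | zero => exact ⟨0, fun t => by simp, by simp⟩
  | add u v _ _ hu hv =>
    obtain ⟨p, hp, hp0⟩ := hu
    obtain ⟨q, hq, hq0⟩ := hv
    exact ⟨p + q, hp.add hq, by rw [Polynomial.coeff_add, hp0, hq0, map_add]⟩
  | smul c u _ hu =>
    obtain ⟨p, hp, hp0⟩ := hu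
    exact ⟨c • p, hp.smul c, by rw [Polynomial.coeff_smul, hp0, map_smul]⟩

section FirstOrder

variable {ι : Type w} [Fintype ι] (X : Module.Basis ι ℂ 𝔤)

/-- Averaging the corrections from `l` to all its permutations expresses the word as a symmetrized
word plus $t$ times shorter ones, which have normal forms by induction. The coefficient of $t$ is
the commutative image of the averaged correction, where the permuted first-order terms cancel. -/
theorem exists_isNormalForm_tensorWord (n : ℕ) : ∀ l : List 𝔤, l.length < n →
    ∃ q, IsNormalForm (tensorWord l) q ∧ q.coeff 0 = symWord l ∧ q.coeff 1 = firstOrder X l := by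
  induction n with
  | zero => intro l hl; omega
  | succ n ih =>
    intro l hl
    choose d hd hE ht using fun σ => exists_perm_correction X (permute_perm l σ).symm
    obtain ⟨q, hq, hq0⟩ := exists_isNormalForm_of_mem (n := l.length)
      (fun l' hl' => by
        obtain ⟨q, hq, hq0, -⟩ := ih l' (by omega)
        exact ⟨q, hq, hq0⟩)
      (Submodule.smul_mem _ (l.length ! : ℂ)⁻¹ (sum_mem (t := Finset.univ) fun σ _ => hd σ))
    refine ⟨Polynomial.C (symWord l) + Polynomial.X * q, fun t => ?_, by simp, ?_⟩
    · rw [Polynomial.eval_add, Polynomial.eval_C, Polynomial.eval_mul, Polynomial.eval_X,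
        ← Algebra.smul_def, map_add, map_smul, ← hq t, symWord, IPBW_list_prod, map_smul, map_sum,
        smul_comm t, Finset.smul_sum (r := t), ← smul_add, ← Finset.sum_add_distrib,
        ← inv_factorial_smul_sum_const l.length (RingQuot.mkAlgHom ℂ (URel 𝔤 t) (tensorWord l))]
      congr 1
      refine Finset.sum_congr rfl fun σ _ => ?_
      rw [ht σ t, mkAlgHom_tensorWord]
    · rw [Polynomial.coeff_add, Polynomial.coeff_X_mul, hq0, map_smul, map_sum]
      simp only [hE]
      rw [Finset.sum_sub_distrib, sum_firstOrder_permute, sub_zero, inv_factorial_smul_sum_const]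
      simp

/-- The product is the double average of concatenated permuted words. In degree 1 the terms internal
to either factor average to zero, and the crossing term is the same for all permutations. -/
theorem exists_symWord_mul (l l' : List 𝔤) :
    ∃ q : Polynomial (SymmetricAlgebra ℂ 𝔤), q.coeff 0 = symWord l * symWord l' ∧
      q.coeff 1 = (2⁻¹ : ℂ) • poissonS X (symWord l) (symWord l') ∧
      ∀ t : ℂ, IPBW 𝔤 t (symWord l) * IPBW 𝔤 t (symWord l') =
        IPBW 𝔤 t (q.eval (algebraMap ℂ (SymmetricAlgebra ℂ 𝔤) t)) := by
  choose q hq hq0 hq1 using fun σ τ =>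
    exists_isNormalForm_tensorWord X _ (permute l σ ++ permute l' τ) (Nat.lt_succ_self _)
  refine ⟨(l.length ! : ℂ)⁻¹ • ∑ σ, (l'.length ! : ℂ)⁻¹ • ∑ τ, q σ τ, ?_, ?_, fun t => ?_⟩
  · simp only [Polynomial.coeff_smul, Polynomial.finsetSum_coeff, hq0, symWord_append,
      symWord_perm (permute_perm l _), symWord_perm (permute_perm l' _),
      inv_factorial_smul_sum_const]
  · have inner : ∀ σ, (l'.length ! : ℂ)⁻¹ • ∑ τ, (q σ τ).coeff 1 =
        firstOrder X (permute l σ) * symWord l' +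
          (2⁻¹ : ℂ) • poissonS X (symWord l) (symWord l') := by
      intro σ
      simp only [hq1, firstOrder_append, symWord_perm (permute_perm l _),
        symWord_perm (permute_perm l' _)]
      rw [Finset.sum_add_distrib, Finset.sum_add_distrib, ← Finset.mul_sum,
        sum_firstOrder_permute, mul_zero, zero_add, smul_add, inv_factorial_smul_sum_const,
        inv_factorial_smul_sum_const]
    simp only [Polynomial.coeff_smul, Polynomial.finsetSum_coeff, inner]
    rw [Finset.sum_add_distrib, ← Finset.sum_mul, sum_firstOrder_permute, zero_mul, zero_add,
      inv_factorial_smul_sum_const]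
  · have h := IsNormalForm.smul (l.length ! : ℂ)⁻¹ (IsNormalForm.sum Finset.univ fun σ =>
      IsNormalForm.smul (l'.length ! : ℂ)⁻¹ (IsNormalForm.sum Finset.univ fun τ => hq σ τ))
    rw [← h t, symWord, symWord, IPBW_list_prod, IPBW_list_prod, smul_mul_assoc, Finset.sum_mul]
    simp only [map_smul, map_sum, tensorWord_append, map_mul, mkAlgHom_tensorWord,
      ← Finset.mul_sum, mul_smul_comm]

end FirstOrder

theorem IPBW_surjective {ι : Type w} [Fintype ι] (X : Module.Basis ι ℂ 𝔤) (t : ℂ) :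
    Function.Surjective (IPBW 𝔤 t) := by
  intro a
  obtain ⟨u, rfl⟩ := RingQuot.mkAlgHom_surjective ℂ (URel 𝔤 t) a
  have h : Submodule.span ℂ (Set.range fun l : List 𝔤 => (l.map (TensorAlgebra.ι ℂ)).prod) ≤
      (LinearMap.range (IPBW 𝔤 t)).comap (RingQuot.mkAlgHom ℂ (URel 𝔤 t)).toLinearMap := by
    refine Submodule.span_le.2 ?_
    rintro _ ⟨l, rfl⟩
    obtain ⟨q, hq, -⟩ := exists_isNormalForm_tensorWord X _ l (Nat.lt_succ_self _)
    exact ⟨_, (hq t).symm⟩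
  exact h (mem_span_prod 𝔤 u)

end WordExpansion

/-! ### The star product and its expansion in $t$ -/

section StarProduct

variable {𝔤 : Type u} [LieRing 𝔤] [LieAlgebra ℂ 𝔤] {ι : Type w} [Fintype ι]

theorem IPBW_bijective (X : Module.Basis ι ℂ 𝔤) (t : ℂ) : Function.Bijective (IPBW 𝔤 t) :=
  ⟨IPBW_injective t, IPBW_surjective X t⟩

/-- The symmetric algebra has a basis of products of vectors. -/
lemma exists_basis_symWord {ι : Type w} (X : Module.Basis ι ℂ 𝔤) :
    ∃ B : Module.Basis (ι →₀ ℕ) ℂ (SymmetricAlgebra ℂ 𝔤), ∀ m, ∃ l, B m = symWord l := by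
  refine ⟨(MvPolynomial.basisMonomials ι ℂ).map
    (SymmetricAlgebra.equivMvPolynomial X).symm.toLinearEquiv, fun m => ?_⟩
  obtain ⟨l, -, hl⟩ := exists_monomial_eq_prod m
  refine ⟨l.map X, ?_⟩
  rw [Module.Basis.map_apply, MvPolynomial.coe_basisMonomials, symWord]
  beta_reduce
  rw [hl]
  exact equivMvPolynomial_symm_prod X l

/-- The star product on `S(𝔤)` with a formal parameter. -/
theorem exists_formal_star (X : Module.Basis ι ℂ 𝔤) :
    ∃ μ : SymmetricAlgebra ℂ 𝔤 →ₗ[ℂ] SymmetricAlgebra ℂ 𝔤 →ₗ[ℂ]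
        Polynomial (SymmetricAlgebra ℂ 𝔤),
      ∀ a b, (μ a b).coeff 0 = a * b ∧ (μ a b).coeff 1 = (2⁻¹ : ℂ) • poissonS X a b ∧
        ∀ t : ℂ, IPBW 𝔤 t a * IPBW 𝔤 t b =
          IPBW 𝔤 t ((μ a b).eval (algebraMap ℂ (SymmetricAlgebra ℂ 𝔤) t)) := by
  obtain ⟨B, hB⟩ := exists_basis_symWord X
  choose l hl using hB
  -- The choices are made only on pairs of basis words and extended bilinearly; all three conditions
  -- are bilinear, so they survive.
  choose q hq0 hq1 hq using fun m m' => exists_symWord_mul X (l m) (l m')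
  have key : ∀ m m', B.constr ℂ (fun m => B.constr ℂ (q m)) (B m) (B m') = q m m' := by
    intro m m'
    rw [Module.Basis.constr_basis, Module.Basis.constr_basis]
  refine ⟨B.constr ℂ fun m => B.constr ℂ (q m), fun a b => ?_⟩
  induction a using basis_induction B with
  | zero => simp
  | add a a' ha ha' =>
    simp only [map_add, LinearMap.add_apply, Polynomial.coeff_add, Polynomial.eval_add, add_mul,
      smul_add, ha.1, ha'.1, ha.2.1, ha'.2.1, ha.2.2, ha'.2.2, implies_true, and_self]
  | smul c a ha =>
    simp only [map_smul, LinearMap.smul_apply, Polynomial.coeff_smul, Polynomial.eval_smul,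
      smul_mul_assoc, ha.1, ha.2.1, ha.2.2, smul_comm c, implies_true, and_self]
  | basis m =>
    induction b using basis_induction B with
    | zero => simp
    | add a a' ha ha' =>
      simp only [map_add, Polynomial.coeff_add, Polynomial.eval_add, mul_add,
        smul_add, ha.1, ha'.1, ha.2.1, ha'.2.1, ha.2.2, ha'.2.2, implies_true, and_self]
    | smul c a ha =>
      simp only [map_smul, Polynomial.coeff_smul, Polynomial.eval_smul,
        mul_smul_comm, ha.1, ha.2.1, ha.2.2, smul_comm c, implies_true, and_self]
    | basis m' =>
      rw [key, hl, hl]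
      exact ⟨hq0 m m', hq1 m m', hq m m'⟩

theorem FPBW_bijective (X : Module.Basis ι ℂ 𝔤) (V : Type v) [AddCommGroup V] [Module ℂ V]
    (t : ℂ) : Function.Bijective (FPBW 𝔤 V t) :=
  (TensorProduct.congr (LinearEquiv.refl ℂ (Module.End ℂ V))
    (LinearEquiv.ofBijective (IPBW 𝔤 t) (IPBW_bijective X t))).bijective

theorem FPBWOne_bijective (X : Module.Basis ι ℂ 𝔤) (V : Type v) [AddCommGroup V]
    [Module ℂ V] : Function.Bijective (FPBWOne 𝔤 V) :=
  (TensorProduct.congr (LinearEquiv.refl ℂ (Module.End ℂ V))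
    (utOneEquiv 𝔤).toLinearEquiv).bijective.comp (FPBW_bijective X V 1)

variable {V : Type v} [AddCommGroup V] [Module ℂ V]

theorem FPBW_star (X : Module.Basis ι ℂ 𝔤) (t : ℂ) (A B : CTilde 𝔤 V) :
    FPBW 𝔤 V t (star t A B) = FPBW 𝔤 V t A * FPBW 𝔤 V t B :=
  Function.invFun_eq ((FPBW_bijective X V t).2 _)

theorem FPBWOne_star (X : Module.Basis ι ℂ 𝔤) (A B : CTilde 𝔤 V) :
    FPBWOne 𝔤 V (star 1 A B) = FPBWOne 𝔤 V A * FPBWOne 𝔤 V B := by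
  have h : ∀ C : QTildeDef 𝔤 V 1,
      TensorProduct.map LinearMap.id (utOneEquiv 𝔤).toLinearMap C =
        Algebra.TensorProduct.map (AlgHom.id ℂ (Module.End ℂ V)) (utOneEquiv 𝔤).toAlgHom C :=
    fun C => rfl
  simp only [FPBWOne, LinearMap.comp_apply, FPBW_star X, h]
  exact map_mul _ _ _

/-- The star product on `End V ⊗ S(𝔤)` is a polynomial deformation of the product with the
noncommutative Poisson bracket as first-order term. -/
theorem exists_star_expansion (X : Module.Basis ι ℂ 𝔤) :
    ∃ m : ℕ → CTilde 𝔤 V →ₗ[ℂ] CTilde 𝔤 V →ₗ[ℂ] CTilde 𝔤 V,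
      ∀ A B : CTilde 𝔤 V, ∃ N : ℕ, (∀ n, N ≤ n → m n A B = 0) ∧
        ∀ t : ℂ, star t A B = A * B + (t / 2) • poisson X A B +
          t ^ 2 • ∑ n ∈ Finset.range N, t ^ n • m n A B := by
  obtain ⟨μ, hμ⟩ := exists_formal_star X
  let c : ℕ → Polynomial (SymmetricAlgebra ℂ 𝔤) →ₗ[ℂ] SymmetricAlgebra ℂ 𝔤 := fun n =>
    (Polynomial.lcoeff (SymmetricAlgebra ℂ 𝔤) n).restrictScalars ℂ
  -- The shift by 2 accounts for the factor $t^2$ taken out of the remainder.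
  let m : ℕ → CTilde 𝔤 V →ₗ[ℂ] CTilde 𝔤 V →ₗ[ℂ] CTilde 𝔤 V := fun n =>
    TensorProduct.map₂ (LinearMap.mul ℂ (Module.End ℂ V)) (μ.compr₂ (c (n + 2)))
  -- Asking for every $N\ge N_0$ lets sums of tensors use the maximum of two bounds. The identity is
  -- checked after $F_{PBW}$, whose injectivity then gives the expansion.
  have key : ∀ A B : CTilde 𝔤 V, ∃ N₀ : ℕ, ∀ N, N₀ ≤ N → m N A B = 0 ∧
      ∀ t : ℂ, FPBW 𝔤 V t A * FPBW 𝔤 V t B = FPBW 𝔤 V t (A * B + (t / 2) • poisson X A B +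
        t ^ 2 • ∑ n ∈ Finset.range N, t ^ n • m n A B) := by
    intro A B
    induction A using TensorProduct.induction_on with
    | zero => exact ⟨0, fun N _ => by simp⟩
    | add A A' hA hA' =>
      obtain ⟨N₁, h₁⟩ := hA
      obtain ⟨N₂, h₂⟩ := hA'
      refine ⟨max N₁ N₂, fun N hN => ⟨?_, fun t => ?_⟩⟩
      · rw [map_add, LinearMap.add_apply, (h₁ N (le_of_max_le_left hN)).1,
          (h₂ N (le_of_max_le_right hN)).1, add_zero]
      · rw [map_add, add_mul, (h₁ N (le_of_max_le_left hN)).2 t,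
          (h₂ N (le_of_max_le_right hN)).2 t, ← map_add]
        congr 1
        simp only [map_add, LinearMap.add_apply, add_mul, smul_add, Finset.sum_add_distrib]
        abel
    | tmul P a =>
      induction B using TensorProduct.induction_on with
      | zero => exact ⟨0, fun N _ => by simp⟩
      | add A A' hA hA' =>
        obtain ⟨N₁, h₁⟩ := hA
        obtain ⟨N₂, h₂⟩ := hA'
        refine ⟨max N₁ N₂, fun N hN => ⟨?_, fun t => ?_⟩⟩
        · rw [map_add, (h₁ N (le_of_max_le_left hN)).1,
            (h₂ N (le_of_max_le_right hN)).1, add_zero]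
        · rw [map_add, mul_add, (h₁ N (le_of_max_le_left hN)).2 t,
            (h₂ N (le_of_max_le_right hN)).2 t, ← map_add]
          congr 1
          simp only [map_add, mul_add, smul_add, Finset.sum_add_distrib]
          abel
      | tmul Q b =>
        obtain ⟨h0, h1, hs⟩ := hμ a b
        have hm : ∀ n, m n (P ⊗ₜ a) (Q ⊗ₜ b) = (P * Q) ⊗ₜ (μ a b).coeff (n + 2) := fun n => rfl
        refine ⟨(μ a b).natDegree, fun N hN => ⟨?_, fun t => ?_⟩⟩
        · rw [hm, Polynomial.coeff_eq_zero_of_natDegree_lt (by omega), TensorProduct.tmul_zero]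
        · have hp : poisson X (P ⊗ₜ a) (Q ⊗ₜ b) = (P * Q) ⊗ₜ poissonS X a b := rfl
          have hF : ∀ (P : Module.End ℂ V) (a : SymmetricAlgebra ℂ 𝔤),
              FPBW 𝔤 V t (P ⊗ₜ a) = P ⊗ₜ IPBW 𝔤 t a := fun _ _ => rfl
          rw [hF, hF, Algebra.TensorProduct.tmul_mul_tmul, hs t, ← hF,
            Polynomial.eval_eq_sum_range' (n := N + 2) (by omega), Finset.sum_range_succ',
            Finset.sum_range_succ', zero_add, h0, h1, hp, Algebra.TensorProduct.tmul_mul_tmul]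
          simp only [hm, ← TensorProduct.tmul_smul, ← TensorProduct.tmul_sum,
            ← TensorProduct.tmul_add]
          congr 2
          rw [Finset.smul_sum]
          simp only [smul_smul, ← map_pow, mul_comm _ (algebraMap _ _ _), ← Algebra.smul_def,
            pow_zero, mul_one, pow_one, ← pow_add, div_eq_mul_inv]
          simp only [add_assoc, add_comm, add_left_comm, one_add_one_eq_two]
  refine ⟨m, fun A B => ?_⟩
  obtain ⟨N, hN⟩ := key A B
  refine ⟨N, fun n hn => (hN n hn).1, fun t => (FPBW_bijective X V t).1 ?_⟩
  rw [FPBW_star X, (hN N le_rfl).2 t]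

end StarProduct

end FamilyAlgebra

end

theorem proposition4p6
    {𝔤 : Type*} [LieRing 𝔤] [LieAlgebra ℂ 𝔤] [FiniteDimensional ℂ 𝔤]
    {V : Type*} [AddCommGroup V] [Module ℂ V] [FiniteDimensional ℂ V]
    [LieRingModule 𝔤 V] [LieModule ℂ 𝔤 V]
    {ι : Type*} [Fintype ι] (X : Module.Basis ι ℂ 𝔤) :
    (∀ t : ℂ, Function.Bijective (FamilyAlgebra.FPBW 𝔤 V t) ∧
      ∀ A B : FamilyAlgebra.CTilde 𝔤 V,
        FamilyAlgebra.FPBW 𝔤 V t (FamilyAlgebra.star t A B) =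
          FamilyAlgebra.FPBW 𝔤 V t A * FamilyAlgebra.FPBW 𝔤 V t B) ∧
    (Function.Bijective (FamilyAlgebra.FPBWOne 𝔤 V) ∧
      ∀ A B : FamilyAlgebra.CTilde 𝔤 V,
        FamilyAlgebra.FPBWOne 𝔤 V (FamilyAlgebra.star 1 A B) =
          FamilyAlgebra.FPBWOne 𝔤 V A * FamilyAlgebra.FPBWOne 𝔤 V B) ∧
    ∃ m : ℕ → FamilyAlgebra.CTilde 𝔤 V →ₗ[ℂ] FamilyAlgebra.CTilde 𝔤 V →ₗ[ℂ]
        FamilyAlgebra.CTilde 𝔤 V,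
      ∀ A B : FamilyAlgebra.CTilde 𝔤 V, ∃ N : ℕ, (∀ n, N ≤ n → m n A B = 0) ∧
        ∀ t : ℂ, FamilyAlgebra.star t A B =
          A * B + (t / 2) • FamilyAlgebra.poisson X A B +
            t ^ 2 • ∑ n ∈ Finset.range N, t ^ n • m n A B := by
  exact ⟨fun t => ⟨FamilyAlgebra.FPBW_bijective X V t, FamilyAlgebra.FPBW_star X t⟩,
    ⟨FamilyAlgebra.FPBWOne_bijective X V, FamilyAlgebra.FPBWOne_star X⟩,
    FamilyAlgebra.exists_star_expansion X⟩
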